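/- Let $G$ be a locally compact second countable (Hausdorff) topological group and let $\Gamma < G$ be a lattice, that is, a discrete subgroup such that there is a fundamental domain of finite (right) Haar measure for the action of $\Gamma$ on $G$ by right translations. Let $(X,\nu)$ be a $G$-space, that is, a standard Borel probability space with a measurable action $G \times X \to X$ of $G$ under which the class of $\nu$-null sets is preserved, and suppose that it is contractive: $\sup_{g \in G} \nu(gB) = 1$ for every measurable set $B \subseteq X$ with $\nu(B) > 0$. Let $\mu$ be a Borel probability measure on $G$ that is symmetric (invariant under $g \mapsto g^{-1}$), whose support generates $G$ as a topological group (the subgroup generated by the support is dense in $G$; this holds in particular if the support generates $G$ as an abstract group), and suppose that $\nu$ is $\mu$-stationary, that is, $\mu * \nu = \nu$, where $(\mu * \nu)(B) = \int_G \nu(g^{-1}B)\, d\mu(g)$. Then the restriction of the action to $\Gamma$ makes $(X,\nu)$ a contractive $\Gamma$-space: it is a $\Gamma$-space and $\sup_{\gamma \in \Gamma} \nu(\gamma B) = 1$ for every measurable set $B \subseteq X$ with $\nu(B) > 0$. -/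

import Mathlib

open MeasureTheory
open scoped Pointwise ENNReal

/-- `(X, ν)` is a `G`-space: a standard Borel probability space with a (jointly measurable)
action of `G` that preserves the class of `ν`-null sets. -/
structure IsGSpace (G : Type*) {X : Type*} [Group G] [MeasurableSpace G] [MulAction G X]
    [MeasurableSpace X] (ν : Measure X) : Prop where
  standardBorel : StandardBorelSpace X
  isProbabilityMeasure : IsProbabilityMeasure ν
  measurableSMul : MeasurableSMul₂ G X
  quasiInvariant : ∀ g : G, Measure.QuasiMeasurePreserving (fun x : X => g • x) ν ν

/-- `sup_g ν(gB) = 1` for every measurable set `B` of positive measure. -/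
def IsContractiveAction (G : Type*) {X : Type*} [Group G] [MulAction G X]
    [MeasurableSpace X] (ν : Measure X) : Prop :=
  ∀ B : Set X, MeasurableSet B → 0 < ν B → ⨆ g : G, ν (g • B) = 1

/-- A contractive `G`-space. -/
structure IsContractiveGSpace (G : Type*) {X : Type*} [Group G] [MeasurableSpace G]
    [MulAction G X] [MeasurableSpace X] (ν : Measure X) : Prop where
  isGSpace : IsGSpace G ν
  contractive : IsContractiveAction G ν

/-- `μ * ν = ν`, where `(μ * ν)(B) = ∫ (gν)(B) dμ(g)` and `(gν)(B) = ν(g⁻¹B)`. -/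
def IsStationaryMeasure {G X : Type*} [Group G] [MeasurableSpace G] [MulAction G X]
    [MeasurableSpace X] (μ : Measure G) (ν : Measure X) : Prop :=
  ∀ B : Set X, MeasurableSet B → ∫⁻ g, ν (g⁻¹ • B) ∂μ = ν B

/-- A lattice: a discrete subgroup `Γ` such that there is a fundamental domain `F` for the
action of `Γ` on `G` by right translations (the quotient by which is `G ⧸ Γ`) of finite Haar
measure. The measure is the *right* Haar measure `E ↦ haar (E⁻¹)`: it is invariant under the
right translations by `Γ`, so that the measure of `F` does not depend on the choice of `F`.
(The condition forces `G` to be unimodular, so that this is then also a left Haar measure.) -/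
def IsLatticeSubgroup {G : Type*} [Group G] [TopologicalSpace G] [IsTopologicalGroup G]
    [LocallyCompactSpace G] [MeasurableSpace G] [BorelSpace G] (Γ : Subgroup G) : Prop :=
  DiscreteTopology Γ ∧
    ∃ F : Set G, IsFundamentalDomain Γ.op F (Measure.haar : Measure G).inv ∧
      (Measure.haar : Measure G).inv F < ∞

/-! Fix `B` with `ν B > 0` and let `H x` be the supremum of `ν (xγB)` over `γ ∈ Γ`, a bounded
function on `G ⧸ Γ`. Stationarity makes `H` subharmonic: `H x ≤ ∫ H (g⁻¹x) dμ`. The lattice provides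
a finite invariant measure on `G ⧸ Γ`, and there a nonnegative bounded subharmonic function has `∬
(H (g⁻¹x) - H x)² = 2‖H‖² - 2∬ H x · H (g⁻¹x) ≤ 0`. With continuity and density of the group
generated by the support, `H` is constant (`apply_eq_of_subharmonic`). Hence `H 1 = H g ≥ ν (gB)`
for all `g`, and contractivity of `G` passes to `Γ`. Continuity of `H` comes from
`eventually_abs_measureReal_smul_sub_le`. -/

open Filter Topology Set

/-- Two finite measures that are within `ε` of each other on an algebra of sets generating the
`σ`-algebra are within `ε` of each other on every measurable set. -/
lemma abs_measureReal_sub_le_of_isSetAlgebra {X : Type*} [m : MeasurableSpace X]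
    {ν₁ ν₂ : Measure X} [IsFiniteMeasure ν₁] [IsFiniteMeasure ν₂] {𝒜 : Set (Set X)}
    (h𝒜 : IsSetAlgebra 𝒜) (hgen : m = MeasurableSpace.generateFrom 𝒜) {ε : ℝ}
    (h : ∀ s ∈ 𝒜, |ν₁.real s - ν₂.real s| ≤ ε) {s : Set X} (hs : MeasurableSet s) :
    |ν₁.real s - ν₂.real s| ≤ ε := by
  refine le_of_forall_pos_le_add fun δ hδ => ?_
  -- Approximating for the sum gives one `t` that serves both measures.
  obtain ⟨t, ht, hst⟩ := (Measure.MeasureDense.of_generateFrom_isSetAlgebra_finite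
    (μ := ν₁ + ν₂) h𝒜 hgen).approx s hs (measure_ne_top _ _) (δ / 2) (half_pos hδ)
  have htm : MeasurableSet t := hgen ▸ MeasurableSpace.measurableSet_generateFrom ht
  have key : ∀ ν' : Measure X, IsFiniteMeasure ν' → ν' ≤ ν₁ + ν₂ →
      |ν'.real s - ν'.real t| ≤ δ / 2 := by
    intro ν' _ hle
    refine (abs_measureReal_sub_le_measureReal_symmDiff hs.nullMeasurableSet
      htm.nullMeasurableSet).trans ?_
    exact ENNReal.toReal_le_of_le_ofReal (half_pos hδ).le ((hle _).trans hst.le)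
  have h1 := key ν₁ inferInstance (Measure.le_add_right le_rfl)
  have h2 := key ν₂ inferInstance (Measure.le_add_left le_rfl)
  have h3 := h t ht
  rw [abs_le] at *
  constructor <;> linarith

lemma measurable_measureReal_smul_set {G : Type*} [Group G] [MeasurableSpace G]
    [MeasurableInv G] {X : Type*} [MeasurableSpace X] [MulAction G X] [MeasurableSMul₂ G X]
    (ν : Measure X) [IsFiniteMeasure ν]
    {s : Set X} (hs : MeasurableSet s) : Measurable fun g : G => ν.real (g • s) := by
  have h : MeasurableSet {p : G × X | p.1⁻¹ • p.2 ∈ s} :=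
    (measurable_fst.inv.smul measurable_snd) hs
  have := (measurable_measure_prodMk_left (ν := ν) h).ennreal_toReal
  convert this using 2 with g
  simp [Measure.real, ← Set.preimage_smul_inv]
  rfl

/-! ### Continuity of translation in total variation -/

section Translation

variable {G : Type*} [Group G] [TopologicalSpace G] [IsTopologicalGroup G]
  [LocallyCompactSpace G] [SecondCountableTopology G] [MeasurableSpace G] [BorelSpace G]
  {X : Type*} [MeasurableSpace X] [MulAction G X] [MeasurableSMul₂ G X]

/-- For a measurable action of a locally compact second countable group that preserves the null
sets of a finite measure `ν`, the translates of `ν` depend continuously in total variation on the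
group element. -/
lemma eventually_abs_measureReal_smul_sub_le [MeasurableSpace.CountablyGenerated X]
    (ν : Measure X) [IsFiniteMeasure ν]
    (hq : ∀ g : G, Measure.QuasiMeasurePreserving (fun x : X => g • x) ν ν) {ε : ℝ} (hε : 0 < ε) :
    ∀ᶠ k in 𝓝 (1 : G), ∀ B : Set X, MeasurableSet B → |ν.real (k • B) - ν.real B| ≤ ε := by
  set 𝒜 := generateSetAlgebra (MeasurableSpace.countableGeneratingSet X)
  have h𝒜 : IsSetAlgebra 𝒜 := isSetAlgebra_generateSetAlgebra
  have h𝒜c : 𝒜.Countable :=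
    countable_generateSetAlgebra MeasurableSpace.countable_countableGeneratingSet
  have hgen : ‹MeasurableSpace X› = MeasurableSpace.generateFrom 𝒜 := by
    rw [generateFrom_generateSetAlgebra_eq, MeasurableSpace.generateFrom_countableGeneratingSet]
  have h𝒜m : ∀ s ∈ 𝒜, MeasurableSet s := fun s hs => by
    rw [hgen]; exact MeasurableSpace.measurableSet_generateFrom hs
  have : Fact ((1 : ℝ≥0∞) ≠ ∞) := ⟨ENNReal.one_ne_top⟩
  let q : ℕ → Lp ℝ 1 ν := TopologicalSpace.denseSeq _
  -- Testing only on the countable algebra keeps `E n` measurable. These sets cover `G`, since every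
  -- translate of `ν` has an `L¹` density, which lies near some `q n`.
  let E : ℕ → Set G := fun n =>
    {g | ∀ s ∈ 𝒜, |ν.real (g • s) - ∫ x in s, q n x ∂ν| ≤ ε / 2}
  have hEm : ∀ n, MeasurableSet (E n) := fun n => by
    have : E n = ⋂ s ∈ 𝒜, {g : G | |ν.real (g • s) - ∫ x in s, q n x ∂ν| ≤ ε / 2} := by
      ext; simp [E]
    rw [this]
    refine MeasurableSet.biInter h𝒜c fun s hs => ?_
    refine measurableSet_le ?_ measurable_const
    have := measurable_measureReal_smul_set (G := G) ν (h𝒜m s hs)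
    exact continuous_abs.measurable.comp (this.sub_const _)
  have hcov : ⋃ n, E n = univ := by
    refine eq_univ_of_forall fun g => ?_
    have hqg := hq g⁻¹
    let ν' := ν.map (fun x : X => g⁻¹ • x)
    have hac : ν' ≪ ν := hqg.absolutelyContinuous
    have hint : Integrable (fun x => (ν'.rnDeriv ν x).toReal) ν := Measure.integrable_toReal_rnDeriv
    obtain ⟨n, hn⟩ := (TopologicalSpace.denseRange_denseSeq (Lp ℝ 1 ν)).exists_dist_lt
      (hint.toL1 _) (half_pos hε)
    refine mem_iUnion.2 ⟨n, fun s hs => ?_⟩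
    have h1 : ν.real (g • s) = ∫ x in s, (hint.toL1 _ : X → ℝ) x ∂ν := by
      rw [setIntegral_congr_ae (g := fun x => (ν'.rnDeriv ν x).toReal) (h𝒜m s hs)
        (hint.coeFn_toL1.mono fun x hx _ => hx), Measure.setIntegral_toReal_rnDeriv hac,
        map_measureReal_apply hqg.measurable (h𝒜m s hs), ← Set.preimage_smul_inv]
    rw [h1, ← integral_sub (L1.integrable_coeFn _).integrableOn (L1.integrable_coeFn _).integrableOn]
    refine (abs_integral_le_integral_abs).trans (le_trans ?_ hn.le)
    rw [L1.dist_eq_integral_dist]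
    simp only [Real.dist_eq]
    exact setIntegral_le_integral ((L1.integrable_coeFn _).sub (L1.integrable_coeFn _)).abs
      (Eventually.of_forall fun x => abs_nonneg _)
  obtain ⟨n, hn⟩ : ∃ n, 0 < (Measure.haar : Measure G) (E n) := by
    by_contra! hcon
    have : (Measure.haar : Measure G) univ = 0 := by
      rw [← hcov]; exact measure_iUnion_null fun n => le_antisymm (hcon n) zero_le
    exact (NeZero.ne (Measure.haar : Measure G)) (Measure.measure_univ_eq_zero.1 this)
  -- Steinhaus: `E n / E n` is a neighbourhood of 1. For `g, h ∈ E n` both translates are `ε /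
  -- 2`-close to `q n`; evaluating at `h⁻¹B` compares `gh⁻¹B` with `B`.
  filter_upwards [Measure.div_mem_nhds_one_of_haar_pos Measure.haar (E n) (hEm n) hn]
  rintro _ ⟨g, hg, h, hh, rfl⟩ B hB
  have hreal : ∀ (g : G) (s : Set X), MeasurableSet s →
      (ν.map (fun x : X => g⁻¹ • x)).real s = ν.real (g • s) := fun g s hs => by
    rw [map_measureReal_apply (measurable_const_smul _) hs, ← Set.preimage_smul_inv]
  have key := abs_measureReal_sub_le_of_isSetAlgebra (ν₁ := ν.map (fun x : X => g⁻¹ • x))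
    (ν₂ := ν.map (fun x : X => h⁻¹ • x)) (ε := ε) h𝒜 hgen (fun s hs => by
      rw [hreal g s (h𝒜m s hs), hreal h s (h𝒜m s hs)]
      have h1 := hg s hs
      have h2 := hh s hs
      rw [abs_le] at *
      constructor <;> linarith) (hB.const_smul h⁻¹)
  rw [hreal g _ (hB.const_smul _), hreal h _ (hB.const_smul _)] at key
  simpa [smul_smul, div_eq_mul_inv] using key

end Translation

/-! ### Unimodularity and subharmonic functions modulo a lattice -/

section Lattice

variable {G : Type*} [Group G] [TopologicalSpace G] [IsTopologicalGroup G]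
  [MeasurableSpace G] [BorelSpace G]

/-- A group with a lattice is unimodular. -/
lemma IsLatticeSubgroup.isMulLeftInvariant_haar_inv [LocallyCompactSpace G]
    [SecondCountableTopology G] {Γ : Subgroup G} (hΓ : IsLatticeSubgroup Γ) :
    (Measure.haar : Measure G).inv.IsMulLeftInvariant := by
  obtain ⟨hd, F, hF, hfin⟩ := hΓ
  have : Countable Γ := countable_of_Lindelof_of_discrete
  have : Countable Γ.op := Γ.equivOp.symm.injective.countable
  set η : Measure G := Measure.haar.inv with hη
  have hη0 : η F ≠ 0 := fun h => by
    have := hF.measure_zero_of_invariant univ (fun g => smul_set_univ) (by simpa using h)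
    exact (NeZero.ne (Measure.haar : Measure G)) (Measure.measure_univ_eq_zero.1
      (by simpa [hη, Measure.inv_apply] using this))
  have hscale : ∀ g : G, ∃ c : ℝ≥0∞, c ≠ 0 ∧ η.map (g * ·) = c • η := fun g => by
    refine ⟨(Measure.modularCharacterFun g⁻¹ : ℝ≥0∞), ?_, ?_⟩
    · simpa using (Measure.modularCharacterFun_pos g⁻¹).ne'
    · have h1 := Measure.map_right_mul_eq_modularCharacterFun_smul (Measure.haar : Measure G) g⁻¹
      rw [hη, Measure.inv_def, Measure.map_map (measurable_const_mul g) measurable_inv]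
      have h2 : ((g * ·) ∘ Inv.inv : G → G) = Inv.inv ∘ (· * g⁻¹) := by ext; simp
      rw [h2, ← Measure.map_map measurable_inv (measurable_mul_const _), h1]
      simp [Measure.map_smul]
  refine ⟨fun g => ?_⟩
  obtain ⟨c, hc0, hc⟩ := hscale g
  have hqm : Measure.QuasiMeasurePreserving (g * · : G → G) η η :=
    ⟨measurable_const_mul g, by rw [hc]; exact Measure.smul_absolutelyContinuous⟩
  -- Left and right translations commute, so `g⁻¹F` is again a fundamental domain. It has the same
  -- finite nonzero measure as `F`, which forces the scaling factor `c` to be 1.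
  have hF' : IsFundamentalDomain Γ.op ((Equiv.mulLeft g).symm '' F) η :=
    hF.image_of_equiv (Equiv.mulLeft g).symm hqm (Equiv.refl _) fun γ x => by
      simp [Subgroup.smul_def, mul_assoc]
  have hms : η ((Equiv.mulLeft g).symm '' F) = c * η F := by
    rw [Equiv.image_symm_eq_preimage]
    have : η.map (g * ·) F = η ((g * ·) ⁻¹' F) :=
      (MeasurableEquiv.mulLeft g).map_apply F
    rw [show (⇑(Equiv.mulLeft g) ⁻¹' F) = (g * ·) ⁻¹' F from rfl, ← this, hc]
    simp
  have hc1 : c = 1 := by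
    rw [hF'.measure_eq hF] at hms
    exact ((ENNReal.mul_eq_right hη0 hfin.ne).1 hms.symm)
  rw [hc, hc1, one_smul]

/-- A nonnegative bounded continuous function that is invariant under a lattice, on one side, and
`μ`-subharmonic, on the other, is constant. -/
lemma apply_eq_of_subharmonic [SecondCountableTopology G] {Γ : Subgroup G}
    [Countable Γ] {η : Measure G} [SFinite η] [η.IsMulLeftInvariant] [η.IsMulRightInvariant]
    [η.IsOpenPosMeasure] {F : Set G} (hF : IsFundamentalDomain Γ.op F η) (hfin : η F < ∞)
    (μ : Measure G) [IsProbabilityMeasure μ] (hgen : Dense (Subgroup.closure μ.support : Set G))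
    {H : G → ℝ} (hc : Continuous H) (h0 : ∀ x, 0 ≤ H x) {C : ℝ} (hC : ∀ x, H x ≤ C)
    (hinv : ∀ x, ∀ γ ∈ Γ, H (x * γ) = H x) (hsub : ∀ x, H x ≤ ∫ g, H (g⁻¹ * x) ∂μ) (x y : G) :
    H x = H y := by
  have : Countable Γ.op := Γ.equivOp.symm.injective.countable
  have hinv' : ∀ (γ : Γ.op) (x : G), H (γ • x) = H x := fun γ x =>
    hinv x _ (Subgroup.mem_op.1 γ.2)
  have hfm : IsFiniteMeasure (η.restrict F) := ⟨by simpa using hfin⟩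
  -- left translations preserve integrals over the fundamental domain
  have htrans : ∀ (u : G → ℝ), (∀ (γ : Γ.op) (x : G), u (γ • x) = u x) → ∀ g : G,
      ∫ x in F, u (g⁻¹ * x) ∂η = ∫ x in F, u x ∂η := fun u hu g => by
    rw [← (hF.smul_of_comm g⁻¹).setIntegral_eq hF hu,
      ← (measurePreserving_mul_left η g⁻¹).setIntegral_preimage_emb
        (measurableEmbedding_mulLeft g⁻¹) u (g⁻¹ • F)]
    congr 2
    ext z
    simp [Set.mem_smul_set_iff_inv_smul_mem]
  let P := μ.prod (η.restrict F)
  have hcg : Continuous fun p : G × G => H (p.1⁻¹ * p.2) := by fun_prop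
  have hcx : Continuous fun p : G × G => H p.2 := by fun_prop
  have hbd : ∀ f : G × G → ℝ, Continuous f → ∀ K : ℝ, (∀ p, |f p| ≤ K) → Integrable f P :=
    fun f hf K hK => Integrable.of_bound hf.aestronglyMeasurable K
      (Eventually.of_forall fun p => by simpa using hK p)
  have hC0 : 0 ≤ C := (h0 1).trans (hC 1)
  have hmul : ∀ a b, |H a * H b| ≤ C * C := fun a b => by
    rw [abs_of_nonneg (mul_nonneg (h0 a) (h0 b))]
    exact mul_le_mul (hC a) (hC b) (h0 b) hC0
  have i1 : Integrable (fun p : G × G => H (p.1⁻¹ * p.2) * H (p.1⁻¹ * p.2)) P :=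
    hbd _ (hcg.mul hcg) _ fun p => hmul _ _
  have i2 : Integrable (fun p : G × G => H p.2 * H p.2) P :=
    hbd _ (hcx.mul hcx) _ fun p => hmul _ _
  have i3 : Integrable (fun p : G × G => H p.2 * H (p.1⁻¹ * p.2)) P :=
    hbd _ (hcx.mul hcg) _ fun p => hmul _ _
  have e1 : ∫ p, H (p.1⁻¹ * p.2) * H (p.1⁻¹ * p.2) ∂P = ∫ x in F, H x * H x ∂η := by
    rw [integral_prod _ i1]
    simp only [htrans (fun x => H x * H x) (fun γ x => by simp only [hinv'])]
    simp
  have e2 : ∫ p, H p.2 * H p.2 ∂P = ∫ x in F, H x * H x ∂η := by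
    rw [integral_prod _ i2]
    simp
  have e3 : ∫ x in F, H x * H x ∂η ≤ ∫ p, H p.2 * H (p.1⁻¹ * p.2) ∂P := by
    rw [integral_prod_symm _ i3]
    refine integral_mono ?_ i3.integral_prod_right fun x => ?_
    · exact Integrable.of_bound (hc.mul hc).aestronglyMeasurable (C * C)
        (Eventually.of_forall fun p => by simpa using hmul p p)
    · simp only [integral_const_mul]
      exact mul_le_mul_of_nonneg_left (hsub x) (h0 x)
  have i4 : Integrable (fun p : G × G => (H (p.1⁻¹ * p.2) - H p.2) ^ 2) P :=
    ((i1.add i2).sub (i3.const_mul 2)).congr (Eventually.of_forall fun p => by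
      simp only [Pi.add_apply, Pi.sub_apply]; ring)
  have e4 : ∫ p, (H (p.1⁻¹ * p.2) - H p.2) ^ 2 ∂P = 0 := by
    refine le_antisymm ?_ (integral_nonneg fun p => sq_nonneg _)
    calc ∫ p, (H (p.1⁻¹ * p.2) - H p.2) ^ 2 ∂P
        = ∫ p, (H (p.1⁻¹ * p.2) * H (p.1⁻¹ * p.2) + H p.2 * H p.2
            - 2 * (H p.2 * H (p.1⁻¹ * p.2))) ∂P := by congr 1; ext p; ring
      _ = (∫ x in F, H x * H x ∂η) + (∫ x in F, H x * H x ∂η)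
            - 2 * ∫ p, H p.2 * H (p.1⁻¹ * p.2) ∂P := by
          rw [integral_sub (f := fun p : G × G => H (p.1⁻¹ * p.2) * H (p.1⁻¹ * p.2) + H p.2 * H p.2)
            (i1.add i2) (i3.const_mul 2), integral_add i1 i2, e1, e2,
            integral_const_mul]
      _ ≤ 0 := by linarith
  have hae : ∀ᵐ g ∂μ, ∀ x, H (g⁻¹ * x) = H x := by
    have h1 := (integral_eq_zero_iff_of_nonneg (fun p => sq_nonneg _) i4).1 e4
    filter_upwards [Measure.ae_ae_of_ae_prod h1] with g hg
    -- The exceptional set is `Γ`-invariant and null in `F`, hence null; continuity then removes it.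
    have hzero : η {x | ¬ H (g⁻¹ * x) = H x} = 0 := by
      refine hF.measure_zero_of_invariant _ (fun γ => ?_) ?_
      · ext x
        rw [Set.mem_smul_set_iff_inv_smul_mem]
        have h2 : g⁻¹ * (γ⁻¹ • x) = γ⁻¹ • (g⁻¹ * x) := by
          simp [Subgroup.smul_def, mul_assoc]
        simp only [Set.mem_ofPred_eq, h2, hinv']
      · rw [← Measure.restrict_apply]
        · refine ae_iff.1 (hg.mono fun x hx => ?_)
          simpa [sub_eq_zero] using hx
        · exact (isClosed_eq (by fun_prop) hc).measurableSet.compl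
    have : (fun x => H (g⁻¹ * x)) = H :=
      Measure.eq_of_ae_eq (μ := η) (ae_iff.2 hzero) (by fun_prop) hc
    exact fun x => congrFun this x
  -- The stabilizer of `H` under left translation is closed and contains the support of `μ`, so it
  -- is all of `G`.
  let S : Subgroup G :=
    { carrier := {g | ∀ x, H (g⁻¹ * x) = H x}
      one_mem' := fun x => by simp
      mul_mem' := fun {a b} ha hb x => by rw [mul_inv_rev, mul_assoc, hb, ha]
      inv_mem' := fun {a} ha x => by
        have := ha (a * x)
        rw [inv_mul_cancel_left] at this
        rw [inv_inv, this] }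
  have hSc : IsClosed (S : Set G) := by
    have : (S : Set G) = ⋂ x, {g : G | H (g⁻¹ * x) = H x} := by ext; simp [S]
    rw [this]
    exact isClosed_iInter fun x => isClosed_eq (by fun_prop) continuous_const
  have hsupp : μ.support ⊆ (S : Set G) := Measure.support_subset_of_isClosed hSc hae
  have hS : (S : Set G) = univ :=
    hSc.closure_eq ▸ (hgen.mono ((Subgroup.closure_le S).2 hsupp)).closure_eq
  have hmem : (x * y⁻¹) ∈ (S : Set G) := hS ▸ mem_univ _
  have := hmem x
  simpa using this.symm

end Lattice

/-- A subgroup acts on a `G`-space. -/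
lemma IsGSpace.restrict_subgroup {G : Type*} [Group G] [MeasurableSpace G] {X : Type*}
    [MeasurableSpace X] [MulAction G X] {ν : Measure X} (h : IsGSpace G ν) (Γ : Subgroup G) :
    IsGSpace Γ ν where
  standardBorel := h.standardBorel
  isProbabilityMeasure := h.isProbabilityMeasure
  measurableSMul := by
    have := h.measurableSMul
    exact ⟨(measurable_subtype_coe.comp measurable_fst).smul measurable_snd⟩
  quasiInvariant γ := h.quasiInvariant γ

/-! ### Passing contractivity to the lattice -/

theorem theoremT {G : Type*} [Group G] [TopologicalSpace G] [IsTopologicalGroup G]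
    [T2Space G] [LocallyCompactSpace G] [SecondCountableTopology G]
    [MeasurableSpace G] [BorelSpace G]
    (Γ : Subgroup G) (hΓ : IsLatticeSubgroup Γ)
    {X : Type*} [MeasurableSpace X] [MulAction G X] (ν : Measure X)
    (hν : IsContractiveGSpace G ν)
    (μ : Measure G) [IsProbabilityMeasure μ]
    (hsymm : μ.IsInvInvariant)
    (hgen : Dense (Subgroup.closure μ.support : Set G))
    (hstat : IsStationaryMeasure μ ν) :
    IsContractiveGSpace Γ ν := by
  refine ⟨hν.isGSpace.restrict_subgroup Γ, fun B hB hB0 => ?_⟩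
  have := hν.isGSpace.standardBorel
  have := hν.isGSpace.isProbabilityMeasure
  have := hν.isGSpace.measurableSMul
  have hcontr := hν.contractive B hB hB0
  have hli := hΓ.isMulLeftInvariant_haar_inv
  obtain ⟨hd, F, hF, hfin⟩ := hΓ
  have : Countable Γ := countable_of_Lindelof_of_discrete
  -- the supremum over the lattice of the measures of the translates of `B`
  let H : G → ℝ := fun x => ⨆ γ : Γ, ν.real ((x * γ) • B)
  have hbdd : ∀ x : G, BddAbove (range fun γ : Γ => ν.real ((x * γ) • B)) := fun x =>
    ⟨1, by rintro _ ⟨γ, rfl⟩; exact measureReal_le_one⟩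
  have hle : ∀ (x : G) (γ : Γ), ν.real ((x * γ) • B) ≤ H x := fun x γ => le_ciSup (hbdd x) γ
  have h0 : ∀ x, 0 ≤ H x := fun x => measureReal_nonneg.trans (hle x 1)
  have h1 : ∀ x, H x ≤ 1 := fun x => ciSup_le fun γ => measureReal_le_one
  have hinv : ∀ x, ∀ γ ∈ Γ, H (x * γ) = H x := fun x γ hγ =>
    (Equiv.mulLeft (⟨γ, hγ⟩ : Γ)).iSup_congr fun δ => by simp [mul_assoc]
  have hc : Continuous H := by
    refine continuous_iff_continuousAt.2 fun x => Metric.tendsto_nhds.2 fun ε hε => ?_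
    -- The estimate is uniform over measurable sets, so one neighbourhood works for all `γ` at once
    -- and survives the supremum.
    have hev := eventually_abs_measureReal_smul_sub_le (G := G) ν hν.isGSpace.quasiInvariant
      (half_pos hε)
    have ht : Tendsto (fun y : G => y * x⁻¹) (𝓝 x) (𝓝 1) := by
      have : Continuous fun y : G => y * x⁻¹ := by fun_prop
      simpa using this.tendsto x
    filter_upwards [ht.eventually hev] with y hy
    have hy' : ∀ γ : Γ, |ν.real ((y * γ) • B) - ν.real ((x * γ) • B)| ≤ ε / 2 := fun γ => by
      have := hy ((x * γ) • B) (hB.const_smul _)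
      rwa [smul_smul, ← mul_assoc, inv_mul_cancel_right] at this
    have hxy : H x ≤ H y + ε / 2 := ciSup_le fun γ => by
      have := (abs_le.1 (hy' γ)).1
      linarith [hle y γ]
    have hyx : H y ≤ H x + ε / 2 := ciSup_le fun γ => by
      have := (abs_le.1 (hy' γ)).2
      linarith [hle x γ]
    rw [Real.dist_eq, abs_lt]
    constructor <;> linarith
  have hsub : ∀ x, H x ≤ ∫ g, H (g⁻¹ * x) ∂μ := fun x => ciSup_le fun γ => by
    have hm := (measurable_measureReal_smul_set (G := G) ν
      (hB.const_smul (x * (γ : G)))).comp measurable_inv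
    have hstat' : ν.real ((x * γ) • B) = ∫ g : G, ν.real (g⁻¹ • (x * (γ : G)) • B) ∂μ := by
      rw [Measure.real, ← hstat _ (hB.const_smul _),
        integral_eq_lintegral_of_nonneg_ae (Eventually.of_forall fun _ => measureReal_nonneg)
          hm.aestronglyMeasurable]
      simp
    rw [hstat']
    refine integral_mono ?_ ?_ fun g => ?_
    · exact Integrable.of_bound hm.aestronglyMeasurable 1 (Eventually.of_forall fun g => by
        simpa only [Function.comp_apply, Real.norm_of_nonneg measureReal_nonneg] using
          measureReal_le_one (μ := ν))
    · have : Continuous fun g : G => H (g⁻¹ * x) := by fun_prop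
      exact Integrable.of_bound this.aestronglyMeasurable 1 (Eventually.of_forall fun g => by
        simpa [abs_of_nonneg (h0 _)] using h1 _)
    · simpa [smul_smul, mul_assoc] using hle (g⁻¹ * x) γ
  have hconst := apply_eq_of_subharmonic hF hfin μ hgen hc h0 h1 hinv hsub
  refine le_antisymm (iSup_le fun γ => prob_le_one) (le_of_forall_lt fun t ht => ?_)
  obtain ⟨g, hg⟩ := lt_iSup_iff.1 (hcontr ▸ ht)
  have hg' : t.toReal < H 1 := by
    rw [hconst 1 g]
    refine lt_of_lt_of_le ?_ (hle g 1)
    simpa [Measure.real] using (ENNReal.toReal_lt_toReal hg.ne_top (measure_ne_top _ _)).2 hg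
  obtain ⟨γ, hγ⟩ := exists_lt_of_lt_ciSup hg'
  refine lt_iSup_iff.2 ⟨γ, ?_⟩
  rw [one_mul] at hγ
  exact (ENNReal.toReal_lt_toReal ht.ne_top (measure_ne_top _ _)).1 hγ
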